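/- Conventions. $L$ is a one-sorted first-order language, $T$ an $L$-theory, and models are non-empty. If $M\models T$ and $x$ is a finite tuple of variables, a Keisler measure $\mu(x)$ on $M$ is a finitely additive probability measure on the Boolean algebra of $M$-definable (with parameters) subsets of $M^{|x|}$; we write $\mu(\phi(x;b))$ for the measure of $\phi(M;b)=\{a\in M^{|x|}: M\models\phi(a;b)\}$. The measure $\mu$ is generically stable if for every $L$-formula $\phi(x;y)$ and every $\epsilon>0$ there are $n\ge 1$ and $a_1,\dots,a_n\in M^{|x|}$ such that $\bigl|\mu(\phi(x;b))-\tfrac1n|\{i: M\models\phi(a_i;b)\}|\bigr|\le\epsilon$ for all $b\in M^{|y|}$. It is smooth if for every elementary extension $N\succeq M$ there is a unique Keisler measure on $N$ extending $\mu$. The theory $T$ is NIP if for every $L$-formula $\phi(x;y)$ there is $d$ such that in no model of $T$ are there $a_i$ ($i<d$) and $b_S$ ($S\subseteq\{0,\dots,d-1\}$) with $\phi(a_i;b_S)\Leftrightarrow i\in S$. The theory $T$ is distal if it is NIP and every generically stable Keisler measure on a model of $T$ is smooth. For a relation $R\subseteq X\times Y$, a pair $(A,B)$ with $A\subseteq X$,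 $B\subseteq Y$ is $R$-homogeneous if $A\times B\subseteq R$ or $(A\times B)\cap R=\emptyset$. **Theorem.** Let $T$ be distal, let $R(x,y;w)$ be an $L$-formula, and let $\beta\in(0,\tfrac12)$. Then there are $\alpha\in(0,1)$ and $L$-formulas $\phi_1(x;z_1)$, $\phi_2(y;z_2)$, depending only on $T$, $R$ and $\beta$, such that the following holds. For every model $M$ of $T$, every $d\in M^{|w|}$, every Keisler measure $\lambda(x)$ on $M$ and every generically stable Keisler measure $\mu(y)$ on $M$, there are parameters $c_1\in M^{|z_1|}$ and $c_2\in M^{|z_2|}$ with $$\lambda(\phi_1(x;c_1))\ge\alpha,\qquad \mu(\phi_2(y;c_2))\ge\beta,$$ such that the pair $(\phi_1(M;c_1),\phi_2(M;c_2))$ is $R(x,y;d)$-homogeneous. (Here $w$ may be the empty tuple.) -/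

import Mathlib

universe u v w

open FirstOrder FirstOrder.Language

namespace DistalTheory

section Measures

variable {L : FirstOrder.Language.{u, v}} {M : Type w} [L.Structure M]

/-- The `M`-definable subset `φ(M; c) = {a ∈ M^α | M ⊨ φ(a; c)}` of `M^α`, as an element of
the Boolean algebra of `M`-definable subsets of `M^α`. -/
def fiber {α β : Type} (φ : L.Formula (α ⊕ β)) (c : β → M) :
    L.DefinableSet (Set.univ : Set M) α :=
  ⟨{a | φ.Realize (Sum.elim a c)}, by
    rw [Set.definable_iff_exists_formula_sum]
    refine ⟨φ.relabel (Sum.elim Sum.inr fun j => Sum.inl ⟨c j, Set.mem_univ _⟩), ?_⟩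
    ext a
    simp only [Set.mem_ofPred_eq, Formula.realize_relabel]
    have h : (Sum.elim (fun x : (Set.univ : Set M) => (x : M)) a ∘
        Sum.elim Sum.inr fun j => Sum.inl ⟨c j, Set.mem_univ _⟩) = Sum.elim a c := by
      funext i
      cases i <;> rfl
    rw [h]⟩

variable (L M) in
/-- A Keisler measure over `M` in the variables `α`: a finitely additive probability measure on
the Boolean algebra of `M`-definable subsets of `M^α`. -/
structure KeislerMeasure (α : Type) where
  /-- the measure of a definable set -/
  toFun : L.DefinableSet (Set.univ : Set M) α → ℝ
  nonneg : ∀ D, 0 ≤ toFun D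
  top_eq_one : toFun ⊤ = 1
  sup_of_disjoint : ∀ D E, Disjoint D E → toFun (D ⊔ E) = toFun D + toFun E

instance {α : Type} : CoeFun (KeislerMeasure L M α)
    (fun _ => L.DefinableSet (Set.univ : Set M) α → ℝ) :=
  ⟨KeislerMeasure.toFun⟩

open Classical in
/-- `Av(a₁, …, a_n; X) = |{i : a_i ∈ X}| / n`. -/
noncomputable def Av {S : Type w} {n : ℕ} (a : Fin n → S) (X : Set S) : ℝ :=
  ((Finset.univ.filter fun i => a i ∈ X).card : ℝ) / n

/-- `μ` is generically stable: for every formula `φ(x; y)` and `ε > 0`, some average of finitely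
many points of `M` is within `ε` of `μ` on all instances `φ(x; b)`, `b` in `M`. -/
def KeislerMeasure.IsGenericallyStable {α : Type} (μ : KeislerMeasure L M α) : Prop :=
  ∀ (k : ℕ) (φ : L.Formula (α ⊕ Fin k)) (ε : ℝ), 0 < ε →
    ∃ (n : ℕ) (a : Fin n → (α → M)), 0 < n ∧
      ∀ b : Fin k → M, |μ (fiber φ b) - Av a (fiber φ b : Set (α → M))| ≤ ε

/-- The measure `ν` over `N` extends the measure `μ` over `M` along the elementary embedding `f`:
every `M`-definable set, read in `N`, keeps its measure. -/
def KeislerMeasure.Extends {α : Type} {N : Type w} [L.Structure N]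
    (ν : KeislerMeasure L N α) (f : M ↪ₑ[L] N) (μ : KeislerMeasure L M α) : Prop :=
  ∀ (k : ℕ) (φ : L.Formula (α ⊕ Fin k)) (b : Fin k → M),
    ν (fiber φ (f ∘ b)) = μ (fiber φ b)

/-- `μ` is smooth: it has a unique extension to every elementary extension of `M`. -/
def KeislerMeasure.IsSmooth {α : Type} (μ : KeislerMeasure L M α) : Prop :=
  ∀ (N : Type w) [L.Structure N] (f : M ↪ₑ[L] N),
    ∃! ν : KeislerMeasure L N α, ν.Extends f μ

end Measures

section Theories

variable {L : FirstOrder.Language.{u, v}}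

/-- `T` is NIP: for every formula `φ(x; y)` there is a `d` such that no `d` tuples in a model of
`T` are shattered by the instances of `φ`. -/
def IsNIP (T : L.Theory) : Prop :=
  ∀ (m n : ℕ) (φ : L.Formula (Fin m ⊕ Fin n)), ∃ d : ℕ,
    ∀ (M : Type (max u v w)) [L.Structure M] [Nonempty M] [M ⊨ T],
      ¬ ∃ (a : Fin d → (Fin m → M)) (b : Set (Fin d) → (Fin n → M)),
        ∀ (i : Fin d) (S : Set (Fin d)), φ.Realize (Sum.elim (a i) (b S)) ↔ i ∈ S

/-- `T` is distal: it is NIP and every generically stable measure, in any finite number of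
variables over any model of `T`, is smooth. Models range over a universe that contains the
language, so by the Löwenheim–Skolem theorem the notion does not depend on `w`. -/
def IsDistal (T : L.Theory) : Prop :=
  IsNIP.{u, v, w} T ∧
    ∀ (M : Type (max u v w)) [L.Structure M] [Nonempty M] [M ⊨ T] (n : ℕ)
      (μ : KeislerMeasure L M (Fin n)), μ.IsGenericallyStable → μ.IsSmooth

end Theories

/-- The pair `(A, B)` is `R`-homogeneous: `R` holds on all of `A × B` or nowhere on `A × B`. -/
def IsHomogeneous {X Y : Type*} (R : X → Y → Prop) (A : Set X) (B : Set Y) : Prop :=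
  (∀ a ∈ A, ∀ b ∈ B, R a b) ∨ (∀ a ∈ A, ∀ b ∈ B, ¬ R a b)

end DistalTheory

/-! The heart is the qualitative statement `KeislerMeasure.IsSmooth.exists_homogeneous`: if μ is
smooth and λ is arbitrary, there are definable A, B with λ(A) > 0, μ(B) > β and (A, B) homogeneous.
Realise a type in the support of λ by a point a of an ultrapower. Smoothness forces the inner and
outer μ-measures of the fibre R(a, ·) over the base model to agree, since otherwise Hahn–Banach
would yield two distinct extensions of μ. So an M-definable B with μ(B) > β lies inside R(a, ·) or
inside its complement, because β < 1/2. By Łoś, B then sits on the same side of R(x, ·) for almost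
all x, and these x form a definable set of positive λ-measure.

Uniformity comes from compactness. If no α, φ₁, φ₂ worked, counterexamples indexed by finite sets of
formulas and by bounds tending to 0 would have an ultraproduct carrying limit measures. The limit of
the μ's is again generically stable: NIP and the Vapnik–Chervonenkis theorem bound the number of
approximating points independently of the model (`IsNIP.exists_uniform_approximation`). Distality
makes this limit smooth, and a homogeneous pair in the ultraproduct descends to a counterexample, a
contradiction. -/

namespace DistalTheory

/-! ### Vapnik–Chervonenkis theory: approximating averages by short averages. -/

section VapnikChervonenkis

open Finset

/-- The sign `±1` attached to a Boolean. -/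
def sgn (b : Bool) : ℝ := if b then 1 else -1

/-- Hoeffding's bound, not normalised: the signs are independent, so the sum factors into hyperbolic
cosines, each at most exp(s²/2). -/
lemma sum_exp_sgn_le {n : ℕ} (v : Fin n → ℝ) (hv : ∀ i, |v i| ≤ 1) (s : ℝ) :
    ∑ σ : Fin n → Bool, Real.exp (s * ∑ i, sgn (σ i) * v i) ≤
      2 ^ n * Real.exp (s ^ 2 * n / 2) := by
  have h : ∑ σ : Fin n → Bool, Real.exp (s * ∑ i, sgn (σ i) * v i) =
      ∏ i : Fin n, ∑ b : Bool, Real.exp (s * (sgn b * v i)) := by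
    rw [Finset.prod_univ_sum, Fintype.piFinset_univ]
    simp only [← Real.exp_sum, Finset.mul_sum]
  have hexp : (2 : ℝ) ^ n * Real.exp (s ^ 2 * n / 2) = ∏ _i : Fin n, 2 * Real.exp (s ^ 2 / 2) := by
    rw [Finset.prod_const, Finset.card_univ, Fintype.card_fin, mul_pow, ← Real.exp_nat_mul]
    ring_nf
  rw [h, hexp]
  refine Finset.prod_le_prod (fun i _ => Finset.sum_nonneg fun _ _ => (Real.exp_pos _).le)
    fun i _ => ?_
  have h1 : ∑ b : Bool, Real.exp (s * (sgn b * v i)) = 2 * Real.cosh (s * v i) := by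
    rw [Fintype.sum_bool, Real.cosh_eq]
    simp only [sgn, if_true, Bool.false_eq_true, if_false]
    ring_nf
  rw [h1]
  refine mul_le_mul_of_nonneg_left ((Real.cosh_le_exp_half_sq _).trans ?_) two_pos.le
  refine Real.exp_le_exp.2 (div_le_div_of_nonneg_right ?_ two_pos.le)
  rw [mul_pow]
  have : v i ^ 2 ≤ 1 := (sq_le_one_iff_abs_le_one _).2 (hv i)
  nlinarith [sq_nonneg s]

/-- A form of Massart's finite class lemma. -/
lemma sum_abs_sgn_lt {n : ℕ} (V : Finset (Fin n → ℝ)) (hV : ∀ v ∈ V, ∀ i, |v i| ≤ 1)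
    (v : (Fin n → Bool) → Fin n → ℝ) (hv : ∀ σ, v σ ∈ V) {ε : ℝ} (hε : 0 < ε)
    (hcard : 2 * (#V : ℝ) < Real.exp (ε ^ 2 * n / 2)) :
    ∑ σ : Fin n → Bool, |∑ i, sgn (σ i) * v σ i| < 2 ^ n * (ε * n) := by
  -- The vector `v σ` may depend on the signs, so it is dominated by the sum over all of `V`; this
  -- is what costs the factor 2·#V.
  have hpt : ∀ σ : Fin n → Bool, Real.exp (ε * |∑ i, sgn (σ i) * v σ i|) ≤
      ∑ w ∈ V, (Real.exp (ε * ∑ i, sgn (σ i) * w i) +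
        Real.exp (-ε * ∑ i, sgn (σ i) * w i)) := by
    intro σ
    let F : (Fin n → ℝ) → ℝ := fun w =>
      Real.exp (ε * ∑ i, sgn (σ i) * w i) + Real.exp (-ε * ∑ i, sgn (σ i) * w i)
    have hF : ∀ w ∈ V, 0 ≤ F w := fun w _ => add_nonneg (Real.exp_pos _).le (Real.exp_pos _).le
    refine le_trans ?_ (Finset.single_le_sum hF (hv σ))
    simp only [F]
    rcases abs_cases (∑ i, sgn (σ i) * v σ i) with ⟨h, -⟩ | ⟨h, -⟩ <;> rw [h]
    · linarith [Real.exp_pos (-ε * ∑ i, sgn (σ i) * v σ i)]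
    · rw [mul_neg, ← neg_mul]
      linarith [Real.exp_pos (ε * ∑ i, sgn (σ i) * v σ i)]
  have hsum : ∑ σ : Fin n → Bool, Real.exp (ε * |∑ i, sgn (σ i) * v σ i|) ≤
      2 ^ n * (2 * #V) * Real.exp (ε ^ 2 * n / 2) := by
    refine (Finset.sum_le_sum fun σ _ => hpt σ).trans ?_
    rw [Finset.sum_comm]
    have : ∀ w ∈ V, ∑ σ : Fin n → Bool, (Real.exp (ε * ∑ i, sgn (σ i) * w i) +
        Real.exp (-ε * ∑ i, sgn (σ i) * w i)) ≤ 2 ^ n * 2 * Real.exp (ε ^ 2 * n / 2) := by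
      intro w hw
      rw [Finset.sum_add_distrib]
      have h1 := sum_exp_sgn_le w (hV w hw) ε
      have h2 := sum_exp_sgn_le w (hV w hw) (-ε)
      rw [neg_sq] at h2
      linarith
    refine (Finset.sum_le_sum this).trans (le_of_eq ?_)
    rw [Finset.sum_const, nsmul_eq_mul]
    ring
  -- The inequality t + 1 ≤ exp t at t = ε|S| − ε²n takes the place of Jensen's inequality and
  -- avoids logarithms.
  have hlin : ∑ σ : Fin n → Bool, (ε * |∑ i, sgn (σ i) * v σ i| - ε ^ 2 * n + 1) ≤
      Real.exp (-(ε ^ 2 * n)) *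
        ∑ σ : Fin n → Bool, Real.exp (ε * |∑ i, sgn (σ i) * v σ i|) := by
    rw [Finset.mul_sum]
    refine Finset.sum_le_sum fun σ _ => ?_
    rw [← Real.exp_add]
    refine le_trans (le_of_eq ?_) (Real.add_one_le_exp _)
    ring
  rw [Finset.sum_add_distrib, Finset.sum_sub_distrib, ← Finset.mul_sum] at hlin
  simp only [Finset.sum_const, Finset.card_univ, Fintype.card_fun, Fintype.card_bool,
    Fintype.card_fin, nsmul_eq_mul, mul_one, Nat.cast_pow, Nat.cast_ofNat] at hlin
  have hlt : Real.exp (-(ε ^ 2 * n)) *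
      ∑ σ : Fin n → Bool, Real.exp (ε * |∑ i, sgn (σ i) * v σ i|) < 2 ^ n := by
    refine (mul_le_mul_of_nonneg_left hsum (Real.exp_pos _).le).trans_lt ?_
    have he : Real.exp (-(ε ^ 2 * n)) * Real.exp (ε ^ 2 * n / 2) * Real.exp (ε ^ 2 * n / 2) = 1 := by
      rw [← Real.exp_add, ← Real.exp_add, Real.exp_eq_one_iff]
      ring
    calc Real.exp (-(ε ^ 2 * n)) * (2 ^ n * (2 * #V) * Real.exp (ε ^ 2 * n / 2))
        = 2 ^ n * (Real.exp (-(ε ^ 2 * n)) * Real.exp (ε ^ 2 * n / 2) * (2 * #V)) := by ring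
      _ < 2 ^ n * (Real.exp (-(ε ^ 2 * n)) * Real.exp (ε ^ 2 * n / 2) *
            Real.exp (ε ^ 2 * n / 2)) := by gcongr
      _ = 2 ^ n := by rw [he, mul_one]
  have : ε * ∑ σ : Fin n → Bool, |∑ i, sgn (σ i) * v σ i| < ε * (2 ^ n * (ε * n)) := by
    linarith
  exact lt_of_mul_lt_mul_left this hε.le

/-- The family of sets `𝒞` shatters a `d`-tuple of points. -/
def ShattersTuple {X : Type*} (𝒞 : Set (Set X)) (d : ℕ) : Prop :=
  ∃ a : Fin d → X, ∀ S : Set (Fin d), ∃ C ∈ 𝒞, ∀ i, a i ∈ C ↔ i ∈ S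

open Classical in
/-- The traces of a family of sets on a finite tuple of points. -/
noncomputable def traces {X ι : Type*} [Fintype ι] (𝒞 : Set (Set X)) (y : ι → X) :
    Finset (Finset ι) :=
  {t : Finset ι | ∃ C ∈ 𝒞, t = ({j | y j ∈ C} : Finset ι)}

open Classical in
lemma mem_traces {X ι : Type*} [Fintype ι] {𝒞 : Set (Set X)} {y : ι → X} {t : Finset ι} :
    t ∈ traces 𝒞 y ↔ ∃ C ∈ 𝒞, t = ({j | y j ∈ C} : Finset ι) := by
  simp [traces]

/-- Polynomial bound on the number of traces of a family that shatters no `d`-tuple. -/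
lemma card_traces_le {X ι : Type*} [Fintype ι] [Nonempty ι] {𝒞 : Set (Set X)} {d : ℕ}
    (hd : ¬ ShattersTuple 𝒞 d) (y : ι → X) :
    #(traces 𝒞 y) ≤ (d + 1) * Fintype.card ι ^ d := by
  classical
  set 𝒯 := traces 𝒞 y with h𝒯
  -- For d > 0 the sharp bound is d − 1; the bound d also covers d = 0, where 𝒞 is empty.
  have hdim : 𝒯.vcDim ≤ d := by
    refine Finset.sup_le fun s hs => ?_
    by_contra! hlt
    obtain ⟨t, hts, htd⟩ := Finset.exists_subset_card_eq hlt.le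
    have hsh : 𝒯.Shatters t := (Finset.mem_shatterer.1 hs).mono_right hts
    let e : Fin d ≃ t := (Fintype.equivFinOfCardEq (by simpa using htd)).symm
    refine hd ⟨fun i => y (e i), fun S => ?_⟩
    obtain ⟨r, hr, hrt⟩ := hsh (t := t.filter fun j => ∃ i ∈ S, (e i : ι) = j)
      (Finset.filter_subset _ _)
    obtain ⟨C, hC, rfl⟩ := mem_traces.1 hr
    refine ⟨C, hC, fun i => ?_⟩
    have := Finset.ext_iff.1 hrt (e i)
    simp only [Finset.mem_inter, Finset.mem_filter, Finset.mem_univ, true_and,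
      Finset.coe_mem] at this
    rw [this]
    constructor
    · rintro ⟨i', hi', h⟩
      rwa [← e.injective (Subtype.ext h)]
    · exact fun h => ⟨i, h, rfl⟩
  calc #𝒯 ≤ #𝒯.shatterer := Finset.card_le_card_shatterer _
    _ ≤ ∑ k ∈ Iic 𝒯.vcDim, (Fintype.card ι).choose k := Finset.card_shatterer_le_sum_vcDim
    _ ≤ ∑ k ∈ Iic d, (Fintype.card ι).choose k :=
        Finset.sum_le_sum_of_subset (Finset.Iic_subset_Iic.2 hdim)
    _ ≤ ∑ _k ∈ Iic d, (Fintype.card ι) ^ d := by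
        refine Finset.sum_le_sum fun k hk => (Nat.choose_le_pow _ _).trans ?_
        exact Nat.pow_le_pow_right Fintype.card_pos (Finset.mem_Iic.1 hk)
    _ = (d + 1) * Fintype.card ι ^ d := by simp

lemma sum_apply_eq {n : ℕ} {Ω : Type*} [Fintype Ω] [DecidableEq Ω] (f : Ω → ℝ) (i : Fin n) :
    ∑ x : Fin n → Ω, f (x i) * Fintype.card Ω = (Fintype.card (Fin n → Ω) : ℝ) * ∑ j, f j := by
  have := Fintype.sum_piFinset_apply (κ := Ω) (ι := Fin n) f Finset.univ i
  rw [Fintype.piFinset_univ] at this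
  rw [← Finset.sum_mul, this, nsmul_eq_mul, Fintype.card_fun, Fintype.card_fin, Finset.card_univ]
  have hn : n = (n - 1) + 1 := by have := i.pos; omega
  have hpow : Fintype.card Ω ^ n = Fintype.card Ω ^ (n - 1) * Fintype.card Ω := by
    rw [← pow_succ, ← hn]
  rw [hpow]
  push_cast
  ring

open Classical in
/-- The Vapnik–Chervonenkis theorem: a sample of fixed size approximates the uniform measure on
a finite set, uniformly on a family that shatters no `d`-tuple. -/
lemma exists_sample {Ω : Type*} [Fintype Ω] [Nonempty Ω] {𝒞 : Set (Set Ω)} {d : ℕ}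
    (hd : ¬ ShattersTuple 𝒞 d) {ε : ℝ} (hε : 0 < ε) {n : ℕ} (hn : 0 < n)
    (hbound : 2 * (((d + 1) * (2 * n) ^ d : ℕ) : ℝ) < Real.exp (ε ^ 2 * n / 2)) :
    ∃ x : Fin n → Ω, ∀ C ∈ 𝒞, |(∑ j, C.indicator (1 : Ω → ℝ) j) / Fintype.card Ω -
      (∑ i, C.indicator (1 : Ω → ℝ) (x i)) / n| ≤ ε := by
  by_contra! hcon
  choose C hC𝒞 hC using hcon
  have hN : (0 : ℝ) < Fintype.card Ω := by exact_mod_cast Fintype.card_pos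
  have hn' : (0 : ℝ) < n := by exact_mod_cast hn
  let χ : Set Ω → Ω → ℝ := fun C => C.indicator 1
  let K : ℝ := Fintype.card (Fin n → Ω)
  have hK : 0 < K := by simp only [K]; exact_mod_cast Fintype.card_pos
  -- comparison with a ghost sample
  have hghost : ∀ x : Fin n → Ω, K * (ε * n) <
      ∑ x' : Fin n → Ω, |∑ i, (χ (C x) (x i) - χ (C x) (x' i))| := by
    intro x
    refine lt_of_lt_of_le ?_ (Finset.abs_sum_le_sum_abs _ _)
    have h1 : ∑ x' : Fin n → Ω, ∑ i, (χ (C x) (x i) - χ (C x) (x' i)) =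
        -(K * n * ((∑ j, χ (C x) j) / Fintype.card Ω - (∑ i, χ (C x) (x i)) / n)) := by
      simp only [Finset.sum_sub_distrib]
      rw [Finset.sum_const, Finset.card_univ, nsmul_eq_mul, Finset.sum_comm (s := univ (α := _ → Ω))]
      have h2 : ∀ i : Fin n, ∑ x' : Fin n → Ω, χ (C x) (x' i) =
          K * (∑ j, χ (C x) j) / Fintype.card Ω := by
        intro i
        rw [eq_div_iff hN.ne', Finset.sum_mul]
        exact sum_apply_eq _ i
      simp only [h2, Finset.sum_const, Finset.card_univ, Fintype.card_fin, nsmul_eq_mul]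
      field_simp
      simp only [K]
      ring
    rw [h1, abs_neg, abs_mul, abs_of_pos (by positivity)]
    have := mul_lt_mul_of_pos_left (hC x) (mul_pos hK hn')
    calc K * (ε * n) = K * n * ε := by ring
      _ < _ := this
  let g : (Fin n → Ω) × (Fin n → Ω) → ℝ := fun p => |∑ i, (χ (C p.1) (p.1 i) - χ (C p.1) (p.2 i))|
  have hlower : K * (K * (ε * n)) < ∑ p, g p := by
    rw [Fintype.sum_prod_type]
    have := Finset.sum_lt_sum_of_nonempty (s := univ (α := Fin n → Ω)) Finset.univ_nonempty
      fun x _ => hghost x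
    rwa [Finset.sum_const, Finset.card_univ, nsmul_eq_mul] at this
  -- exchanging the coordinates of the two samples
  let sw : (Fin n → Bool) → (Fin n → Ω) × (Fin n → Ω) → (Fin n → Ω) × (Fin n → Ω) := fun σ p =>
    (fun i => if σ i then p.1 i else p.2 i, fun i => if σ i then p.2 i else p.1 i)
  have hsw : ∀ σ, Function.Involutive (sw σ) := by
    intro σ p
    ext i <;> by_cases h : σ i <;> simp [sw, h]
  have hsym : ∀ σ, ∑ p, g (sw σ p) = ∑ p, g p := fun σ =>
    Equiv.sum_comp (hsw σ).toPerm g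
  have hg : ∀ σ p, g (sw σ p) =
      |∑ i, sgn (σ i) * (χ (C (sw σ p).1) (p.1 i) - χ (C (sw σ p).1) (p.2 i))| := by
    intro σ p
    simp only [g]
    congr 1
    refine Finset.sum_congr rfl fun i _ => ?_
    by_cases h : σ i <;> simp [sw, sgn, h]
  have hupper : ∀ p : (Fin n → Ω) × (Fin n → Ω), ∑ σ, g (sw σ p) < 2 ^ n * (ε * n) := by
    intro p
    simp only [hg]
    have : Nonempty (Fin n ⊕ Fin n) := ⟨Sum.inl ⟨0, hn⟩⟩
    -- The bad set changes with σ, but only its trace on the 2n points of `p` matters, and there are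
    -- polynomially many traces.
    have hcard := card_traces_le hd (Sum.elim p.1 p.2)
    set 𝒯 := traces 𝒞 (Sum.elim p.1 p.2)
    let ind : Finset (Fin n ⊕ Fin n) → Fin n ⊕ Fin n → ℝ := fun t j => if j ∈ t then 1 else 0
    let D : Finset (Fin n ⊕ Fin n) → Fin n → ℝ := fun t i =>
      ind t (Sum.inl i) - ind t (Sum.inr i)
    refine sum_abs_sgn_lt (𝒯.image D) ?_
      (fun σ i => χ (C (sw σ p).1) (p.1 i) - χ (C (sw σ p).1) (p.2 i)) ?_ hε ?_
    · intro v hv i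
      obtain ⟨t, -, rfl⟩ := Finset.mem_image.1 hv
      simp only [D, ind]
      split_ifs <;> simp
    · intro σ
      have hmem : ({j | Sum.elim p.1 p.2 j ∈ C (sw σ p).1} : Finset (Fin n ⊕ Fin n)) ∈ 𝒯 :=
        mem_traces.2 ⟨_, hC𝒞 _, rfl⟩
      have hD : (fun i => χ (C (sw σ p).1) (p.1 i) - χ (C (sw σ p).1) (p.2 i)) =
          D {j | Sum.elim p.1 p.2 j ∈ C (sw σ p).1} := by
        funext i
        simp [D, ind, χ, Set.indicator_apply]
      rw [hD]
      exact Finset.mem_image_of_mem D hmem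
    · refine lt_of_le_of_lt ?_ hbound
      rw [Fintype.card_sum, Fintype.card_fin, ← two_mul] at hcard
      have hDcard : #(𝒯.image D) ≤ #𝒯 := Finset.card_image_le
      have := hDcard.trans hcard
      exact mul_le_mul_of_nonneg_left (Nat.cast_le.2 this) two_pos.le
  have htotal : ∑ σ : Fin n → Bool, ∑ p, g (sw σ p) < K * K * (2 ^ n * (ε * n)) := by
    rw [Finset.sum_comm]
    have := Finset.sum_lt_sum_of_nonempty (s := univ (α := (Fin n → Ω) × (Fin n → Ω)))
      Finset.univ_nonempty fun p _ => hupper p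
    rwa [Finset.sum_const, Finset.card_univ, nsmul_eq_mul, Fintype.card_prod, Nat.cast_mul] at this
  simp only [hsym, Finset.sum_const, Finset.card_univ, Fintype.card_fun, Fintype.card_bool,
    Fintype.card_fin, nsmul_eq_mul, Nat.cast_pow, Nat.cast_ofNat] at htotal
  have h2n : (0 : ℝ) < 2 ^ n := by positivity
  nlinarith [mul_lt_mul_of_pos_left hlower h2n]

lemma exists_sample_size (d : ℕ) {ε : ℝ} (hε : 0 < ε) : ∃ n : ℕ, 0 < n ∧
    2 * (((d + 1) * (2 * n) ^ d : ℕ) : ℝ) < Real.exp (ε ^ 2 * n / 2) := by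
  have h := (isLittleO_pow_exp_pos_mul_atTop d (b := ε ^ 2 / 2) (by positivity)).comp_tendsto
    (tendsto_natCast_atTop_atTop (R := ℝ))
  -- The 4, in place of the 2 of the goal, leaves room for a strict inequality.
  have h' := (h.def (c := 1 / (4 * (d + 1) * 2 ^ d)) (by positivity)).and
    (Filter.eventually_gt_atTop 0)
  obtain ⟨n, hn, hn0⟩ := h'.exists
  refine ⟨n, hn0, ?_⟩
  simp only [Function.comp_apply, norm_pow, Real.norm_eq_abs, Real.abs_exp, Nat.abs_cast] at hn
  rw [one_div, inv_mul_eq_div, le_div_iff₀ (by positivity)] at hn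
  have hpos : (0 : ℝ) < (d + 1) * 2 ^ d * n ^ d := by positivity
  push_cast
  rw [mul_pow]
  have : ε ^ 2 * n / 2 = ε ^ 2 / 2 * n := by ring
  rw [this]
  nlinarith

lemma Av_eq_sum {S : Type w} {n : ℕ} (a : Fin n → S) (X : Set S) :
    Av a X = (∑ i, (a ⁻¹' X).indicator (1 : Fin n → ℝ) i) / n := by
  classical
  unfold Av
  congr 1
  simp [Set.indicator_apply]

/-- Finite averages are approximated by averages of bounded length, uniformly on a family that
shatters no `d`-tuple. -/
theorem exists_bounded_average (d : ℕ) {ε : ℝ} (hε : 0 < ε) : ∃ n : ℕ, 0 < n ∧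
    ∀ {X : Type w} (𝒞 : Set (Set X)), ¬ ShattersTuple 𝒞 d → ∀ {N : ℕ} (a : Fin N → X), 0 < N →
      ∃ x : Fin n → X, ∀ C ∈ 𝒞, |Av a C - Av x C| ≤ ε := by
  obtain ⟨n, hn, hbound⟩ := exists_sample_size d hε
  refine ⟨n, hn, fun {X} 𝒞 h𝒞 {N} a hN => ?_⟩
  have : Nonempty (Fin N) := ⟨⟨0, hN⟩⟩
  -- Indices are sampled rather than points, so repetitions in `a` keep their weight. Pulling back
  -- along `a` creates no shattering.
  have hd : ¬ ShattersTuple ((fun C => a ⁻¹' C) '' 𝒞) d := by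
    rintro ⟨b, hb⟩
    refine h𝒞 ⟨a ∘ b, fun S => ?_⟩
    obtain ⟨_, ⟨C, hC, rfl⟩, h⟩ := hb S
    exact ⟨C, hC, h⟩
  obtain ⟨x, hx⟩ := exists_sample hd hε hn hbound
  refine ⟨a ∘ x, fun C hC => ?_⟩
  have := hx _ ⟨C, hC, rfl⟩
  rw [Fintype.card_fin] at this
  rw [Av_eq_sum, Av_eq_sum]
  exact this

end VapnikChervonenkis

end DistalTheory

namespace DistalTheory

/-! ### Extending finitely additive measures by Hahn–Banach. -/

section Extension

/-- The bounded real functions on `X`. -/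
def boundedFunctions (X : Type*) : Submodule ℝ (X → ℝ) where
  carrier := {f | ∃ C, ∀ x, |f x| ≤ C}
  zero_mem' := ⟨0, fun x => by simp⟩
  add_mem' := by
    rintro f g ⟨C, hC⟩ ⟨C', hC'⟩
    exact ⟨C + C', fun x => (abs_add_le _ _).trans (add_le_add (hC x) (hC' x))⟩
  smul_mem' := by
    rintro c f ⟨C, hC⟩
    refine ⟨|c| * C, fun x => ?_⟩
    rw [Pi.smul_apply, smul_eq_mul, abs_mul]
    exact mul_le_mul_of_nonneg_left (hC x) (abs_nonneg c)

/-- The indicator function of a set, as a bounded function. -/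
noncomputable def bddIndicator {X : Type*} (S : Set X) : boundedFunctions X :=
  ⟨S.indicator 1, 1, fun x => by by_cases h : x ∈ S <;> simp [h]⟩

lemma bddIndicator_apply {X : Type*} (S : Set X) (x : X) :
    (bddIndicator S : X → ℝ) x = S.indicator 1 x := rfl

variable {X 𝒜 : Type*}

/-- The integral of the simple function coded by a list of coefficients and sets. -/
def simpleInt (μ : 𝒜 → ℝ) (l : List (ℝ × 𝒜)) : ℝ := (l.map fun p => p.1 * μ p.2).sum

@[simp] lemma simpleInt_cons (μ : 𝒜 → ℝ) (p : ℝ × 𝒜) (l : List (ℝ × 𝒜)) :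
    simpleInt μ (p :: l) = p.1 * μ p.2 + simpleInt μ l := by
  simp [simpleInt]

@[simp] lemma simpleInt_nil (μ : 𝒜 → ℝ) : simpleInt μ [] = 0 := by simp [simpleInt]

lemma simpleInt_append (μ : 𝒜 → ℝ) (l l' : List (ℝ × 𝒜)) :
    simpleInt μ (l ++ l') = simpleInt μ l + simpleInt μ l' := by
  simp [simpleInt]

lemma simpleInt_smul (μ : 𝒜 → ℝ) (c : ℝ) (l : List (ℝ × 𝒜)) :
    simpleInt μ (l.map fun p => (c * p.1, p.2)) = c * simpleInt μ l := by
  induction l with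
  | nil => simp
  | cons p l ih => rw [List.map_cons, simpleInt_cons, simpleInt_cons, ih]; ring

variable [BooleanAlgebra 𝒜] (ι : BoundedLatticeHom 𝒜 (Set X)) (μ : 𝒜 → ℝ)

/-- The value at `x` of the simple function coded by a list of coefficients and sets. -/
noncomputable def simpleVal (l : List (ℝ × 𝒜)) (x : X) : ℝ :=
  (l.map fun p => p.1 * (ι p.2).indicator 1 x).sum

/-- The upper integral of a bounded function. -/
noncomputable def upperInt (f : boundedFunctions X) : ℝ :=
  sInf {r | ∃ l : List (ℝ × 𝒜), (∀ x, (f : X → ℝ) x ≤ simpleVal ι l x) ∧ r = simpleInt μ l}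

@[simp] lemma simpleVal_cons (p : ℝ × 𝒜) (l : List (ℝ × 𝒜)) (x : X) :
    simpleVal ι (p :: l) x = p.1 * (ι p.2).indicator 1 x + simpleVal ι l x := by
  simp [simpleVal]

@[simp] lemma simpleVal_nil (x : X) : simpleVal ι [] x = 0 := by simp [simpleVal]

lemma simpleVal_append (l l' : List (ℝ × 𝒜)) (x : X) :
    simpleVal ι (l ++ l') x = simpleVal ι l x + simpleVal ι l' x := by
  simp [simpleVal]

lemma simpleVal_smul (c : ℝ) (l : List (ℝ × 𝒜)) (x : X) :
    simpleVal ι (l.map fun p => (c * p.1, p.2)) x = c * simpleVal ι l x := by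
  induction l with
  | nil => simp
  | cons p l ih => rw [List.map_cons, simpleVal_cons, simpleVal_cons, ih]; ring

variable {ι μ} (hnn : ∀ A, 0 ≤ μ A) (htop : μ ⊤ = 1)
  (hadd : ∀ A B, Disjoint A B → μ (A ⊔ B) = μ A + μ B) (hnull : ∀ A, ι A = ∅ → μ A = 0)

include hadd in
lemma measure_split (A B : 𝒜) : μ A = μ (A ⊓ B) + μ (A ⊓ Bᶜ) := by
  rw [← hadd, ← inf_sup_left, sup_compl_eq_top, inf_top_eq]
  exact (disjoint_compl_right (a := B)).mono inf_le_right inf_le_right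

include hnn hadd hnull in
/-- A simple function above the indicator of `D` on `B` yields a set covering `D` on `B`. -/
lemma exists_cover_of_le_simpleVal (D : Set X) (l : List (ℝ × 𝒜)) : ∀ (c : ℝ) (B : 𝒜),
    (∀ x ∈ ι B, D.indicator (1 : X → ℝ) x ≤ c + simpleVal ι l x) →
    ∃ A, D ∩ ι B ⊆ ι A ∧
      μ A ≤ c * μ B + simpleInt μ (l.map fun p => (p.1, p.2 ⊓ B)) := by
  -- `B` is the current cell of the partition cut out by the sets already read, and `c` is the sum
  -- of their coefficients there. On a final cell meeting `D` one has c ≥ 1 and the whole cell is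
  -- taken; otherwise nothing is.
  induction l with
  | nil =>
    intro c B h
    have hbot : μ ⊥ = 0 := hnull _ (by rw [map_bot]; rfl)
    by_cases hD : (D ∩ ι B).Nonempty
    · obtain ⟨x, hxD, hxB⟩ := hD
      have := h x hxB
      rw [Set.indicator_of_mem hxD, simpleVal_nil, add_zero, Pi.one_apply] at this
      refine ⟨B, Set.inter_subset_right, ?_⟩
      rw [List.map_nil, simpleInt_nil]
      nlinarith [hnn B]
    · refine ⟨⊥, by rw [Set.not_nonempty_iff_eq_empty.1 hD]; exact Set.empty_subset _, ?_⟩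
      rw [List.map_nil, simpleInt_nil, add_zero, hbot]
      by_cases hB : (ι B).Nonempty
      · obtain ⟨x, hx⟩ := hB
        have h1 := h x hx
        rw [Set.indicator_of_notMem fun hxD => hD ⟨x, hxD, hx⟩, simpleVal_nil, add_zero] at h1
        exact mul_nonneg h1 (hnn B)
      · rw [hnull B (Set.not_nonempty_iff_eq_empty.1 hB), mul_zero]
  | cons p l ih =>
    intro c B h
    obtain ⟨A₁, hA₁, hμ₁⟩ := ih (c + p.1) (B ⊓ p.2) (by
      intro x hx
      rw [map_inf] at hx
      have := h x hx.1
      rw [simpleVal_cons, Set.indicator_of_mem (s := ι p.2) hx.2, Pi.one_apply] at this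
      linarith)
    obtain ⟨A₂, hA₂, hμ₂⟩ := ih c (B ⊓ p.2ᶜ) (by
      intro x hx
      rw [map_inf, map_compl'] at hx
      have := h x hx.1
      rw [simpleVal_cons, Set.indicator_of_notMem (s := ι p.2) hx.2] at this
      linarith)
    refine ⟨A₁ ⊔ A₂, ?_, ?_⟩
    · rintro x ⟨hxD, hxB⟩
      rw [map_sup]
      by_cases hx : x ∈ ι p.2
      · exact Or.inl (hA₁ ⟨hxD, by rw [map_inf]; exact ⟨hxB, hx⟩⟩)
      · exact Or.inr (hA₂ ⟨hxD, by rw [map_inf, map_compl']; exact ⟨hxB, hx⟩⟩)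
    · have hsub : μ (A₁ ⊔ A₂) ≤ μ A₁ + μ A₂ := by
        have h1 := measure_split hadd A₂ A₁
        have h2 := hadd A₁ (A₂ ⊓ A₁ᶜ)
          ((disjoint_compl_right (a := A₁)).mono_right inf_le_right)
        rw [← sdiff_eq, sup_sdiff_self_right] at h2
        rw [← sdiff_eq] at h1
        linarith [hnn (A₂ ⊓ A₁)]
      have hint : ∀ l : List (ℝ × 𝒜), simpleInt μ (l.map fun q => (q.1, q.2 ⊓ B)) =
          simpleInt μ (l.map fun q => (q.1, q.2 ⊓ (B ⊓ p.2))) +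
          simpleInt μ (l.map fun q => (q.1, q.2 ⊓ (B ⊓ p.2ᶜ))) := by
        intro l
        induction l with
        | nil => simp
        | cons q l ih =>
          simp only [List.map_cons, simpleInt_cons]
          rw [ih, measure_split hadd (q.2 ⊓ B) p.2, inf_assoc, inf_assoc]
          ring
      have hB := measure_split hadd B p.2
      rw [List.map_cons, simpleInt_cons, hint l, inf_comm p.2 B, hB]
      simp only at *
      linarith

include hnn hadd hnull in
-- Simple functions do no better than sets: the upper integral of an indicator is an outer measure.
-- Thus the value prescribed in Hahn–Banach is realised by covers.
lemma exists_cover_of_indicator_le (D : Set X) (l : List (ℝ × 𝒜))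
    (h : ∀ x, D.indicator (1 : X → ℝ) x ≤ simpleVal ι l x) :
    ∃ A, D ⊆ ι A ∧ μ A ≤ simpleInt μ l := by
  obtain ⟨A, hA, hμ⟩ := exists_cover_of_le_simpleVal hnn hadd hnull D l 0 ⊤
    fun x _ => by rw [zero_add]; exact h x
  refine ⟨A, fun x hx => hA ⟨hx, by rw [map_top]; trivial⟩, hμ.trans_eq ?_⟩
  simp

include hnn hadd hnull in
lemma simpleInt_nonneg (l : List (ℝ × 𝒜)) (h : ∀ x, 0 ≤ simpleVal ι l x) :
    0 ≤ simpleInt μ l := by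
  obtain ⟨A, -, hA⟩ := exists_cover_of_indicator_le hnn hadd hnull ∅ l (by simpa using h)
  exact (hnn A).trans hA

include hnn htop hadd hnull in
lemma upperInt_le (f : boundedFunctions X) (l : List (ℝ × 𝒜))
    (h : ∀ x, (f : X → ℝ) x ≤ simpleVal ι l x) : upperInt ι μ f ≤ simpleInt μ l := by
  refine csInf_le ?_ ⟨l, h, rfl⟩
  obtain ⟨C, hC⟩ := f.2
  refine ⟨-C, ?_⟩
  rintro _ ⟨l', hl', rfl⟩
  have := simpleInt_nonneg hnn hadd hnull ((C, ⊤) :: l') fun x => by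
    have h1 := hl' x
    have h2 := neg_abs_le ((f : X → ℝ) x)
    have h3 := hC x
    rw [simpleVal_cons, map_top, Set.top_eq_univ, Set.indicator_univ, Pi.one_apply]
    linarith
  rw [simpleInt_cons, htop] at this
  linarith

lemma exists_simple_of_upperInt_lt (f : boundedFunctions X) {r : ℝ} (h : upperInt ι μ f < r) :
    ∃ l : List (ℝ × 𝒜), (∀ x, (f : X → ℝ) x ≤ simpleVal ι l x) ∧ simpleInt μ l < r := by
  obtain ⟨C, hC⟩ := f.2
  have hC' : ∀ x, (f : X → ℝ) x ≤ simpleVal ι [(C, ⊤)] x := fun x => by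
    rw [simpleVal_cons, map_top, Set.top_eq_univ, Set.indicator_univ, Pi.one_apply]
    simpa using (le_abs_self _).trans (hC x)
  have hne : {r | ∃ l : List (ℝ × 𝒜), (∀ x, (f : X → ℝ) x ≤ simpleVal ι l x) ∧
      r = simpleInt μ l}.Nonempty := ⟨_, _, hC', rfl⟩
  obtain ⟨_, ⟨l, hl, rfl⟩, hlt⟩ := exists_lt_of_csInf_lt hne h
  exact ⟨l, hl, hlt⟩

include hnn htop hadd hnull in
lemma upperInt_add_le (f g : boundedFunctions X) :
    upperInt ι μ (f + g) ≤ upperInt ι μ f + upperInt ι μ g := by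
  refine le_of_forall_pos_lt_add fun ε hε => ?_
  obtain ⟨l, hl, hl'⟩ := exists_simple_of_upperInt_lt (ι := ι) (μ := μ) f
    (lt_add_of_pos_right _ (half_pos hε))
  obtain ⟨k, hk, hk'⟩ := exists_simple_of_upperInt_lt (ι := ι) (μ := μ) g
    (lt_add_of_pos_right _ (half_pos hε))
  have := upperInt_le hnn htop hadd hnull (f + g) (l ++ k) fun x => by
    rw [simpleVal_append]
    exact add_le_add (hl x) (hk x)
  rw [simpleInt_append] at this
  linarith

include hnn htop hadd hnull in
lemma upperInt_smul_le {c : ℝ} (hc : 0 < c) (f : boundedFunctions X) :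
    upperInt ι μ (c • f) ≤ c * upperInt ι μ f := by
  refine le_of_forall_pos_lt_add fun ε hε => ?_
  obtain ⟨l, hl, hl'⟩ := exists_simple_of_upperInt_lt (ι := ι) (μ := μ) f
    (lt_add_of_pos_right _ (div_pos hε hc))
  have := upperInt_le hnn htop hadd hnull (c • f) (l.map fun p => (c * p.1, p.2)) fun x => by
    rw [simpleVal_smul]
    exact mul_le_mul_of_nonneg_left (hl x) hc.le
  rw [simpleInt_smul] at this
  have h2 := mul_lt_mul_of_pos_left hl' hc
  rw [mul_add, mul_div_cancel₀ _ hc.ne'] at h2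
  linarith

include hnn htop hadd hnull in
lemma upperInt_smul {c : ℝ} (hc : 0 < c) (f : boundedFunctions X) :
    upperInt ι μ (c • f) = c * upperInt ι μ f := by
  refine (upperInt_smul_le hnn htop hadd hnull hc f).antisymm ?_
  have := upperInt_smul_le hnn htop hadd hnull (inv_pos.2 hc) (c • f)
  rw [inv_smul_smul₀ hc.ne', inv_mul_eq_div, le_div_iff₀ hc] at this
  linarith

include hnn htop hadd hnull in
/-- A finitely additive probability measure on an algebra of subsets of `X` extends to all subsets
of `X`, and the extension can be chosen to give a prescribed set its outer measure. -/
theorem exists_extension_outer (D : Set X) : ∃ ν : Set X → ℝ, (∀ B, 0 ≤ ν B) ∧ ν Set.univ = 1 ∧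
    (∀ B C, Disjoint B C → ν (B ∪ C) = ν B + ν C) ∧ (∀ A, ν (ι A) = μ A) ∧
    ∀ ε > 0, ∃ A, D ⊆ ι A ∧ μ A < ν D + ε := by
  have hadd' := upperInt_add_le hnn htop hadd hnull
  have hsmul := fun c (hc : 0 < c) f => upperInt_smul (ι := ι) hnn htop hadd hnull hc f
  have hzero : upperInt ι μ 0 = 0 := by
    have := hsmul 2 two_pos 0
    rw [smul_zero] at this
    linarith
  -- Hahn–Banach from the line spanned by the indicator of `D`, where the largest value allowed by
  -- the sublinear `upperInt` is prescribed. For negative multiples the domination is subadditivity.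
  obtain ⟨F, hFD, hF⟩ : ∃ F : boundedFunctions X →ₗ[ℝ] ℝ,
      F (bddIndicator D) = upperInt ι μ (bddIndicator D) ∧ ∀ f, F f ≤ upperInt ι μ f := by
    have hH : ∀ c : ℝ, c • bddIndicator D = 0 → c • upperInt ι μ (bddIndicator D) = 0 := by
      intro c hc
      rcases smul_eq_zero.1 hc with h | h
      · rw [h, zero_smul]
      · rw [h, hzero, smul_zero]
    obtain ⟨F, hF', hF⟩ := exists_extension_of_le_sublinear
      (LinearPMap.mkSpanSingleton' (σ := RingHom.id ℝ) (bddIndicator D)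
        (upperInt ι μ (bddIndicator D)) hH)
      (upperInt ι μ) hsmul hadd' (by
        rintro ⟨x, hx⟩
        obtain ⟨c, rfl⟩ := Submodule.mem_span_singleton.1 hx
        rw [LinearPMap.mkSpanSingleton'_apply, RingHom.id_apply, smul_eq_mul]
        rcases lt_trichotomy c 0 with hc | rfl | hc
        · have h1 := hadd' (c • bddIndicator D) ((-c) • bddIndicator D)
          rw [← add_smul, add_neg_cancel, zero_smul, hzero, hsmul (-c) (neg_pos.2 hc)] at h1
          simp only
          linarith
        · simp only [zero_smul, zero_mul, hzero, le_refl]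
        · exact (hsmul c hc _).ge)
    refine ⟨F, ?_, hF⟩
    have h1 := hF' ⟨bddIndicator D, Submodule.mem_span_singleton_self _⟩
    have h2 := LinearPMap.mkSpanSingleton'_apply_self (σ := RingHom.id ℝ) (bddIndicator D)
      (upperInt ι μ (bddIndicator D)) hH (Submodule.mem_span_singleton_self _)
    exact h1.trans h2
  -- Domination at both the indicator and its negative pins `F` to `μ` on the algebra.
  have hνA : ∀ A, F (bddIndicator (ι A)) = μ A := by
    intro A
    apply le_antisymm
    · refine (hF _).trans ((upperInt_le hnn htop hadd hnull _ [(1, A)] fun x => ?_).trans_eq ?_)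
      · simp [bddIndicator_apply]
      · simp
    · have h1 : upperInt ι μ (-bddIndicator (ι A)) ≤ - μ A :=
        (upperInt_le hnn htop hadd hnull _ [(-1, A)] fun x => by
          rw [simpleVal_cons, simpleVal_nil, add_zero, neg_one_mul]
          exact le_of_eq rfl).trans_eq (by simp)
      have h2 := hF (-bddIndicator (ι A))
      rw [map_neg] at h2
      linarith
  refine ⟨fun B => F (bddIndicator B), fun B => ?_, ?_, fun B C hBC => ?_, hνA, fun ε hε => ?_⟩
  · have h1 : upperInt ι μ (-bddIndicator B) ≤ 0 :=
      (upperInt_le hnn htop hadd hnull _ [] fun x => by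
        rw [simpleVal_nil]
        exact neg_nonpos.2 (Set.indicator_nonneg (fun _ _ => zero_le_one) x)).trans_eq (by simp)
    have h2 := hF (-bddIndicator B)
    rw [map_neg] at h2
    linarith
  · rw [← htop, ← hνA, map_top]
    rfl
  · have : bddIndicator (B ∪ C) = bddIndicator B + bddIndicator C :=
      Subtype.ext (Set.indicator_union_of_disjoint hBC (1 : X → ℝ))
    simp only [this, map_add]
  · simp only [hFD]
    obtain ⟨l, hl, hlt⟩ := exists_simple_of_upperInt_lt (ι := ι) (bddIndicator D)
      (lt_add_of_pos_right _ hε)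
    obtain ⟨A, hA, hμ⟩ := exists_cover_of_indicator_le hnn hadd hnull D l hl
    exact ⟨A, hA, hμ.trans_lt hlt⟩

end Extension

end DistalTheory

namespace DistalTheory

/-! ### Internal sets of ultraproducts and Łoś's theorem. -/

section Internal

open Filter Topology

variable {L : FirstOrder.Language.{u, v}} {I : Type*} {U : Ultrafilter I} {M : I → Type*}
  {α : Type}

/-- The class in the ultraproduct of a family of tuples. -/
def ultraTuple (U : Ultrafilter I) (x : ∀ i, α → M i) : α → (U : Filter I).Product M :=
  fun j => ((fun i => x i j : ∀ i, M i) : (U : Filter I).Product M)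

/-- Representatives of a tuple of the ultraproduct. -/
noncomputable def ultraOut (y : α → (U : Filter I).Product M) (i : I) : α → M i :=
  fun j => (y j).out i

lemma ultraTuple_ultraOut (y : α → (U : Filter I).Product M) : ultraTuple U (ultraOut y) = y :=
  funext fun j => Quotient.out_eq' (y j)

lemma ultraTuple_eq_iff [Finite α] {x x' : ∀ i, α → M i} :
    ultraTuple U x = ultraTuple U x' ↔ ∀ᶠ i in (U : Filter I), x i = x' i := by
  simp only [funext_iff, eventually_all]
  exact forall_congr' fun j => Quotient.eq''

lemma ultraOut_ultraTuple [Finite α] (x : ∀ i, α → M i) :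
    ∀ᶠ i in (U : Filter I), ultraOut (ultraTuple U x) i = x i :=
  ultraTuple_eq_iff.1 (ultraTuple_ultraOut _)

/-- The internal subset of an ultraproduct given by a family of sets. -/
def internalSet (U : Ultrafilter I) (S : ∀ i, Set (α → M i)) :
    Set (α → (U : Filter I).Product M) :=
  {y | ∀ᶠ i in (U : Filter I), ultraOut y i ∈ S i}

lemma ultraTuple_mem_internalSet [Finite α] {S : ∀ i, Set (α → M i)} {x : ∀ i, α → M i} :
    ultraTuple U x ∈ internalSet U S ↔ ∀ᶠ i in (U : Filter I), x i ∈ S i := by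
  refine eventually_congr ((ultraOut_ultraTuple x).mono fun i hi => ?_)
  rw [hi]

/-- Counterexamples chosen at almost every index would assemble into one in the ultraproduct. The
sets `S i` need not be definable. -/
lemma eventually_subset_of_internalSet_subset [Finite α] [∀ i, Nonempty (M i)]
    {S S' : ∀ i, Set (α → M i)} (h : internalSet U S ⊆ internalSet U S') :
    ∀ᶠ i in (U : Filter I), S i ⊆ S' i := by
  by_contra hcon
  rw [← Ultrafilter.eventually_not] at hcon
  have hx : ∀ i, ∃ x : α → M i, ¬ S i ⊆ S' i → x ∈ S i ∧ x ∉ S' i := by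
    intro i
    by_cases hi : S i ⊆ S' i
    · exact ⟨fun _ => Classical.arbitrary _, fun h => absurd hi h⟩
    · obtain ⟨x, hx⟩ := Set.not_subset.1 hi
      exact ⟨x, fun _ => hx⟩
  choose x hx using hx
  have h1 : ultraTuple U x ∈ internalSet U S :=
    ultraTuple_mem_internalSet.2 (hcon.mono fun i hi => (hx i hi).1)
  obtain ⟨i, hi, hi'⟩ := (hcon.and (ultraTuple_mem_internalSet.1 (h h1))).exists
  exact (hx i hi).2 hi'

lemma eventually_eq_of_internalSet_eq [Finite α] [∀ i, Nonempty (M i)]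
    {S S' : ∀ i, Set (α → M i)} (h : internalSet U S = internalSet U S') :
    ∀ᶠ i in (U : Filter I), S i = S' i := by
  filter_upwards [eventually_subset_of_internalSet_subset h.subset,
    eventually_subset_of_internalSet_subset h.symm.subset] with i h1 h2
  exact h1.antisymm h2

variable (U) in
/-- The Boolean homomorphism sending a family of sets to an internal set. -/
def internalHom : BoundedLatticeHom (∀ i, Set (α → M i)) (Set (α → (U : Filter I).Product M)) where
  toFun := internalSet U
  map_sup' S S' := by
    ext y
    exact Ultrafilter.eventually_or
  map_inf' S S' := by
    ext y
    exact eventually_and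
  map_top' := Set.eq_univ_of_forall fun y => Eventually.of_forall fun i => Set.mem_univ _
  map_bot' := Set.eq_empty_of_forall_notMem fun y hy => by
    obtain ⟨i, hi⟩ := Eventually.exists hy
    exact hi

lemma elim_ultraTuple {β : Type} (x : ∀ i, α → M i) (b : ∀ i, β → M i) :
    Sum.elim (ultraTuple U x) (ultraTuple U b) = ultraTuple U fun i => Sum.elim (x i) (b i) := by
  funext j
  cases j <;> rfl

variable [∀ i, L.Structure (M i)] [∀ i, Nonempty (M i)]

lemma realize_ultraTuple {γ : Type} (φ : L.Formula γ) (x : ∀ i, γ → M i) :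
    φ.Realize (ultraTuple U x) ↔ ∀ᶠ i in (U : Filter I), φ.Realize (x i) :=
  Ultraproduct.realize_formula_cast φ fun j i => x i j

/-- An instance of a formula in the ultraproduct is internal. -/
lemma coe_fiber_ultraTuple {β : Type} (φ : L.Formula (α ⊕ β)) (b : ∀ i, β → M i) :
    (fiber φ (ultraTuple U b) : Set (α → (U : Filter I).Product M)) =
      internalSet U fun i => (fiber φ (b i) : Set (α → M i)) := by
  ext y
  change φ.Realize (Sum.elim y (ultraTuple U b)) ↔ _
  rw [← ultraTuple_ultraOut y, elim_ultraTuple, realize_ultraTuple, ultraTuple_ultraOut]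
  rfl

end Internal

/-! ### Definable sets as instances of formulas. -/

section Fibers

variable {L : FirstOrder.Language.{u, v}} {M : Type w} [L.Structure M] {α : Type}

lemma mem_fiber {β : Type} {φ : L.Formula (α ⊕ β)} {c : β → M} {a : α → M} :
    a ∈ (fiber φ c : Set (α → M)) ↔ φ.Realize (Sum.elim a c) := Iff.rfl

/-- Every definable set is an instance of a formula. -/
lemma exists_eq_fiber (D : L.DefinableSet (Set.univ : Set M) α) :
    ∃ (k : ℕ) (φ : L.Formula (α ⊕ Fin k)) (b : Fin k → M), D = fiber φ b := by
  obtain ⟨A, -, hA⟩ := Set.definable_iff_finitely_definable.1 D.2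
  obtain ⟨φ, hφ⟩ := Set.definable_iff_exists_formula_sum.1 hA
  let e := A.equivFin
  refine ⟨A.card, φ.relabel (Sum.elim (fun x => Sum.inr (e x)) Sum.inl),
    fun j => (e.symm j : M), Subtype.ext ?_⟩
  rw [hφ]
  ext a
  change φ.Realize _ ↔ Formula.Realize _ _
  rw [Formula.realize_relabel]
  have : Sum.elim (fun x : ((A : Set M) : Type w) => (x : M)) a =
      Sum.elim a (fun j => (e.symm j : M)) ∘ Sum.elim (fun x => Sum.inr (e x)) Sum.inl := by
    funext j
    cases j with
    | inl x => exact (congrArg Subtype.val (e.symm_apply_apply x)).symm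
    | inr x => rfl
  rw [← this]

/-- Once the second side B of a homogeneous pair is known, this set serves as the first side. -/
lemma definable_forall_mem {β γ : Type} [Finite β] (R : L.Formula ((α ⊕ β) ⊕ γ)) (d : γ → M)
    (B : L.DefinableSet (Set.univ : Set M) β) :
    (Set.univ : Set M).Definable L
      {x : α → M | ∀ y ∈ B, R.Realize (Sum.elim (Sum.elim x y) d)} := by
  have h1 := (fiber R d).2
  have h2 := B.2.preimage_comp (Sum.inr : β → α ⊕ β)
  have h3 := (h2.compl.union h1).forall_of_finite
  convert h3 using 1
  ext x
  refine forall_congr' fun y => ?_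
  simp only [Set.mem_union, Set.mem_compl_iff, ← imp_iff_not_or]
  rfl

end Fibers

/-! ### Elementary properties of Keisler measures. -/

section Measures

variable {L : FirstOrder.Language.{u, v}} {M : Type w} [L.Structure M] {α : Type}

lemma KeislerMeasure.compl (μ : KeislerMeasure L M α) (D : L.DefinableSet (Set.univ : Set M) α) :
    μ Dᶜ = 1 - μ D := by
  have := μ.sup_of_disjoint D Dᶜ disjoint_compl_right
  rw [sup_compl_eq_top, μ.top_eq_one] at this
  linarith

lemma KeislerMeasure.bot (μ : KeislerMeasure L M α) : μ ⊥ = 0 := by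
  have := μ.compl ⊤
  rw [compl_top, μ.top_eq_one] at this
  linarith

lemma KeislerMeasure.mono (μ : KeislerMeasure L M α) {D E : L.DefinableSet (Set.univ : Set M) α}
    (h : D ≤ E) : μ D ≤ μ E := by
  have := μ.sup_of_disjoint D (E ⊓ Dᶜ) ((disjoint_compl_right (a := D)).mono_right inf_le_right)
  rw [← sdiff_eq, sup_sdiff_cancel_right h] at this
  have h2 := μ.nonneg (E \ D)
  linarith

lemma KeislerMeasure.le_one (μ : KeislerMeasure L M α)
    (D : L.DefinableSet (Set.univ : Set M) α) : μ D ≤ 1 :=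
  μ.top_eq_one ▸ μ.mono le_top

/-- An ultrafilter containing no definable null set. -/
lemma KeislerMeasure.exists_ultrafilter {α : Type} (ν : KeislerMeasure L M α) :
    ∃ U : Ultrafilter (α → M), ∀ D : L.DefinableSet (Set.univ : Set M) α,
      (D : Set (α → M)) ∈ U → 0 < ν D := by
  -- The filter generated by definable sets of full measure; an ultrafilter above it contains no
  -- definable null set, since the complement is already in the filter.
  let F : Filter (α → M) :=
    { sets := {S | ∃ D : L.DefinableSet (Set.univ : Set M) α, (D : Set (α → M)) ⊆ S ∧ ν D = 1}
      univ_sets := ⟨⊤, Set.subset_univ _, ν.top_eq_one⟩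
      sets_of_superset := fun ⟨D, hD, h1⟩ h => ⟨D, hD.trans h, h1⟩
      inter_sets := by
        rintro S S' ⟨D, hD, h1⟩ ⟨D', hD', h1'⟩
        refine ⟨D ⊓ D', Set.inter_subset_inter hD hD', le_antisymm (ν.le_one _) ?_⟩
        have h := measure_split ν.sup_of_disjoint D D'
        have h2 := ν.mono (inf_le_right : D ⊓ D'ᶜ ≤ D'ᶜ)
        rw [ν.compl, h1'] at h2
        linarith }
  have : F.NeBot := by
    rw [← Filter.empty_mem_iff_bot.not.trans Filter.neBot_iff.symm]
    rintro ⟨D, hD, h1⟩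
    have : D = ⊥ := SetLike.coe_injective (Set.subset_empty_iff.1 hD)
    rw [this, ν.bot] at h1
    exact zero_ne_one h1
  refine ⟨Ultrafilter.of F, fun D hD => (ν.nonneg D).lt_of_ne fun h0 => ?_⟩
  have : (D : Set (α → M))ᶜ ∈ F := ⟨Dᶜ, subset_rfl, by rw [ν.compl, ← h0, sub_zero]⟩
  exact Ultrafilter.compl_mem_iff_notMem.1 (Ultrafilter.of_le F this) hD

end Measures

/-! ### Smooth measures and homogeneous pairs. -/

section Smooth

open Filter

variable {L : FirstOrder.Language.{u, v}} {M : Type w} [L.Structure M] [Nonempty M]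

/-- The diagonal embedding into an ultrapower. -/
def diagonalEmbedding {I : Type*} (U : Ultrafilter I) :
    M ↪ₑ[L] (U : Filter I).Product fun _ => M where
  toFun x := ((fun _ => x : ∀ _ : I, M) : (U : Filter I).Product fun _ => M)
  map_formula' _ φ x :=
    (realize_ultraTuple (U := U) φ fun _ => x).trans eventually_const

/-- The extension to an ultrapower of the definable sets of a structure. -/
def ultrapowerHom {I : Type*} (U : Ultrafilter I) (α : Type) :
    BoundedLatticeHom (L.DefinableSet (Set.univ : Set M) α)
      (Set (α → (U : Filter I).Product fun _ => M)) where
  toFun A := internalHom U fun _ => (A : Set (α → M))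
  map_sup' A B := map_sup (internalHom U) (fun _ => (A : Set (α → M))) fun _ => B
  map_inf' A B := InfHomClass.map_inf (internalHom U) (fun _ => (A : Set (α → M))) fun _ => B
  map_top' := map_top (internalHom U)
  map_bot' := map_bot (internalHom U)

/-- The inner and outer measures of a definable set of an ultrapower, with respect to a smooth
measure on the base structure, agree. -/
lemma KeislerMeasure.IsSmooth.exists_cover {α : Type} [Finite α] {μ : KeislerMeasure L M α}
    (hμ : μ.IsSmooth) {I : Type w} (U : Ultrafilter I)
    (D : L.DefinableSet (Set.univ : Set ((U : Filter I).Product fun _ => M)) α)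
    {ε : ℝ} (hε : 0 < ε) :
    ∃ A A' : L.DefinableSet (Set.univ : Set M) α,
      (D : Set (α → (U : Filter I).Product fun _ => M)) ⊆ internalSet U (fun _ => A) ∧
      (D : Set (α → (U : Filter I).Product fun _ => M))ᶜ ⊆ internalSet U (fun _ => A') ∧
      μ A + μ A' < 1 + ε := by
  have hnull : ∀ A : L.DefinableSet (Set.univ : Set M) α, ultrapowerHom U α A = ∅ → μ A = 0 := by
    intro A hA
    have h1 : internalSet U (fun _ => (A : Set (α → M))) = internalSet U (fun _ => ∅) :=
      hA.trans (map_bot (internalHom U)).symm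
    obtain ⟨-, h2⟩ := (eventually_eq_of_internalSet_eq h1).exists
    have : A = ⊥ := SetLike.coe_injective h2
    rw [this, μ.bot]
  have hext : ∀ E : Set (α → (U : Filter I).Product fun _ => M),
      ∃ ν : KeislerMeasure L ((U : Filter I).Product fun _ => M) α,
        ν.Extends (diagonalEmbedding U) μ ∧ ∀ D : L.DefinableSet Set.univ α,
          (D : Set (α → (U : Filter I).Product fun _ => M)) = E →
          ∀ δ > 0, ∃ A, E ⊆ ultrapowerHom U α A ∧ μ A < ν D + δ := by
    intro E
    obtain ⟨ν, hν0, hν1, hνadd, hνA, hνE⟩ := exists_extension_outer μ.nonneg μ.top_eq_one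
      μ.sup_of_disjoint hnull E
    refine ⟨⟨fun B => ν B, fun B => hν0 _, hν1, fun B C hBC => ?_⟩, ?_, ?_⟩
    · refine hνadd _ _ (Set.disjoint_left.2 fun x hx hx' => ?_)
      exact DefinableSet.notMem_bot (hBC.le_bot (show x ∈ B ⊓ C from ⟨hx, hx'⟩))
    · intro k φ b
      rw [← hνA (fiber φ b)]
      exact congrArg ν (coe_fiber_ultraTuple (U := U) φ fun _ => b)
    · rintro D rfl δ hδ
      exact hνE δ hδ
  obtain ⟨ν, hν, hνD⟩ := hext D
  obtain ⟨ν', hν', hνD'⟩ := hext (Dᶜ : L.DefinableSet Set.univ α)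
  -- One extension gives `D` its outer measure, the other gives `Dᶜ` its own. Smoothness identifies
  -- them, so the two outer measures add up to 1.
  obtain rfl : ν = ν' := (hμ _ (diagonalEmbedding U)).unique hν hν'
  obtain ⟨A, hA, hAμ⟩ := hνD D rfl _ (half_pos hε)
  obtain ⟨A', hA', hAμ'⟩ := hνD' Dᶜ rfl _ (half_pos hε)
  rw [ν.compl] at hAμ'
  exact ⟨A, A', hA, hA', by linarith⟩

/-- Over a smooth measure, an arbitrary measure yields a homogeneous pair. -/
theorem KeislerMeasure.IsSmooth.exists_homogeneous {α β γ : Type} [Finite α] [Finite β]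
    (R : L.Formula ((α ⊕ β) ⊕ γ)) (d : γ → M) (lam : KeislerMeasure L M α)
    {μ : KeislerMeasure L M β} (hμ : μ.IsSmooth) {r : ℝ} (hr : r < 1 / 2) :
    ∃ (A : L.DefinableSet (Set.univ : Set M) α) (B : L.DefinableSet (Set.univ : Set M) β),
      0 < lam A ∧ r < μ B ∧
      IsHomogeneous (fun a b => R.Realize (Sum.elim (Sum.elim a b) d))
        (A : Set (α → M)) (B : Set (β → M)) := by
  obtain ⟨U, hU⟩ := lam.exists_ultrafilter
  -- The class of the identity on M^α realises the type of `U`, which lies in the support of `lam`.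
  let a : α → (U : Filter (α → M)).Product fun _ => M := ultraTuple U fun x => x
  let d' : γ → (U : Filter (α → M)).Product fun _ => M := ultraTuple U fun _ => d
  let σ : (α ⊕ β) ⊕ γ → β ⊕ (α ⊕ γ) :=
    Sum.elim (Sum.elim (Sum.inr ∘ Sum.inl) Sum.inl) (Sum.inr ∘ Sum.inr)
  have key : ∀ (P : L.Formula ((α ⊕ β) ⊕ γ)) (B : L.DefinableSet (Set.univ : Set M) β),
      internalSet U (fun _ => (B : Set (β → M))) ⊆
        (fiber (P.relabel σ) (Sum.elim a d') : Set (β → (U : Filter (α → M)).Product fun _ => M)) →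
      ∃ A : L.DefinableSet (Set.univ : Set M) α, 0 < lam A ∧
        ∀ x ∈ A, ∀ y ∈ B, P.Realize (Sum.elim (Sum.elim x y) d) := by
    intro P B h
    refine ⟨⟨_, definable_forall_mem P d B⟩, hU _ ?_, fun x hx => hx⟩
    have h1 : (Sum.elim a d') = ultraTuple U fun x => Sum.elim x d := elim_ultraTuple _ _
    rw [h1, coe_fiber_ultraTuple] at h
    filter_upwards [eventually_subset_of_internalSet_subset h] with x hx y hy
    have := hx hy
    rw [mem_fiber, Formula.realize_relabel] at this
    convert this using 1
    funext j
    rcases j with (j | j) | j <;> rfl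
  obtain ⟨A, A', hA, hA', hAA'⟩ := hμ.exists_cover U (fiber (R.relabel σ) (Sum.elim a d'))
    (ε := 1 - 2 * r) (by linarith)
  have hcompl : ∀ A : L.DefinableSet (Set.univ : Set M) β,
      internalSet U (fun _ => ((Aᶜ : L.DefinableSet (Set.univ : Set M) β) : Set (β → M))) =
        (internalSet U (fun _ => (A : Set (β → M))))ᶜ := fun A =>
    map_compl' (ultrapowerHom U β) A
  -- `A'ᶜ` lies inside the fibre of R at `a` and `Aᶜ` outside it. By the choice ε = 1 − 2r their
  -- measures sum to more than 2r.
  by_cases h : r < μ A'ᶜ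
  · obtain ⟨E, hE, hE'⟩ := key R A'ᶜ (by rw [hcompl]; exact Set.compl_subset_comm.1 hA')
    exact ⟨E, A'ᶜ, hE, h, Or.inl hE'⟩
  · obtain ⟨E, hE, hE'⟩ := key R.not Aᶜ (by
      rw [hcompl]
      refine (Set.compl_subset_compl.2 hA).trans fun y hy => ?_
      rw [mem_fiber, Formula.realize_relabel, Formula.realize_not, ← Formula.realize_relabel]
      exact hy)
    refine ⟨E, Aᶜ, hE, ?_, Or.inr hE'⟩
    rw [μ.compl] at h ⊢
    linarith

end Smooth

end DistalTheory

namespace DistalTheory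

/-! ### Ultraproducts of Keisler measures. -/

section UltraMeasure

open Filter Topology

variable {L : FirstOrder.Language.{u, v}} {I : Type*} {U : Ultrafilter I} {M : I → Type*}
  [∀ i, L.Structure (M i)] [∀ i, Nonempty (M i)] {α : Type}

/-- Every definable set of an ultraproduct is an ultraproduct of definable sets. -/
lemma exists_eq_internalSet
    (D : L.DefinableSet (Set.univ : Set ((U : Filter I).Product M)) α) :
    ∃ S : ∀ i, L.DefinableSet (Set.univ : Set (M i)) α,
      (D : Set (α → (U : Filter I).Product M)) = internalSet U fun i => (S i : Set (α → M i)) := by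
  obtain ⟨k, φ, b, rfl⟩ := exists_eq_fiber D
  refine ⟨fun i => fiber φ (ultraOut b i), ?_⟩
  rw [← coe_fiber_ultraTuple, ultraTuple_ultraOut]

lemma exists_tendsto_of_mem_Icc {f : I → ℝ} (hf : ∀ i, f i ∈ Set.Icc (0 : ℝ) 1) :
    ∃ r, Tendsto f U (𝓝 r) := by
  obtain ⟨r, -, hr⟩ := isCompact_Icc.ultrafilter_le_nhds (U.map f)
    (le_principal_iff.2 (Filter.mem_map.2 (Filter.univ_mem' hf)))
  exact ⟨r, hr⟩

variable (U) in
/-- The value at a definable set of the ultraproduct of a family of measures. -/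
noncomputable def ultraMeasureFun (lam : ∀ i, KeislerMeasure L (M i) α)
    (D : L.DefinableSet (Set.univ : Set ((U : Filter I).Product M)) α) : ℝ :=
  limUnder (U : Filter I) fun i => lam i ((exists_eq_internalSet D).choose i)

/-- Independence of the chosen representatives: two families with the same internal set agree at
almost every index. -/
lemma tendsto_ultraMeasureFun [Finite α] (lam : ∀ i, KeislerMeasure L (M i) α)
    {D : L.DefinableSet (Set.univ : Set ((U : Filter I).Product M)) α}
    {S : ∀ i, L.DefinableSet (Set.univ : Set (M i)) α}
    (hS : (D : Set (α → (U : Filter I).Product M)) =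
      internalSet U fun i => (S i : Set (α → M i))) :
    Tendsto (fun i => lam i (S i)) U (𝓝 (ultraMeasureFun U lam D)) := by
  have h := eventually_eq_of_internalSet_eq ((exists_eq_internalSet D).choose_spec.symm.trans hS)
  refine (tendsto_nhds_limUnder (exists_tendsto_of_mem_Icc fun i =>
    ⟨(lam i).nonneg _, (lam i).le_one _⟩)).congr' ?_
  filter_upwards [h] with i hi
  rw [SetLike.coe_injective hi]

variable (U) in
/-- The ultraproduct of a family of Keisler measures. -/
noncomputable def ultraMeasure [Finite α] (lam : ∀ i, KeislerMeasure L (M i) α) :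
    KeislerMeasure L ((U : Filter I).Product M) α where
  toFun := ultraMeasureFun U lam
  nonneg D := by
    obtain ⟨S, hS⟩ := exists_eq_internalSet D
    exact ge_of_tendsto' (tendsto_ultraMeasureFun lam hS) fun i => (lam i).nonneg _
  top_eq_one := by
    refine tendsto_nhds_unique (tendsto_ultraMeasureFun lam (D := ⊤) (S := fun _ => ⊤)
      (TopHomClass.map_top (internalHom U)).symm) ?_
    simp only [(lam _).top_eq_one]
    exact tendsto_const_nhds
  sup_of_disjoint D E hDE := by
    obtain ⟨S, hS⟩ := exists_eq_internalSet D
    obtain ⟨S', hS'⟩ := exists_eq_internalSet E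
    have hsup := tendsto_ultraMeasureFun lam (D := D ⊔ E) (S := fun i => S i ⊔ S' i) (by
      rw [DefinableSet.coe_sup, hS, hS']
      exact (map_sup (internalHom U) (fun i => (S i : Set (α → M i))) fun i => S' i).symm)
    refine tendsto_nhds_unique hsup (((tendsto_ultraMeasureFun lam hS).add
      (tendsto_ultraMeasureFun lam hS')).congr' ?_)
    -- Disjointness in the ultraproduct gives disjoint representatives only at almost every index,
    -- which is enough for the limit.
    have hdisj : internalSet U (fun i => (S i : Set (α → M i)) ⊓ S' i) ⊆
        internalSet U fun _ => ∅ := by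
      refine ((InfHomClass.map_inf (internalHom U) (fun i => (S i : Set (α → M i)))
        fun i => S' i).trans ?_).subset.trans (Set.empty_subset _)
      change internalSet U _ ∩ internalSet U _ = ∅
      rw [← hS, ← hS', ← DefinableSet.coe_inf, hDE.eq_bot]
      rfl
    filter_upwards [eventually_subset_of_internalSet_subset hdisj] with i hi
    refine ((lam i).sup_of_disjoint _ _ (disjoint_iff_inf_le.2 ?_)).symm
    exact hi

lemma tendsto_ultraMeasure_fiber [Finite α] (lam : ∀ i, KeislerMeasure L (M i) α) {β : Type}
    (φ : L.Formula (α ⊕ β)) (b : ∀ i, β → M i) :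
    Tendsto (fun i => lam i (fiber φ (b i))) U
      (𝓝 (ultraMeasure U lam (fiber φ (ultraTuple U b)))) :=
  tendsto_ultraMeasureFun lam (coe_fiber_ultraTuple φ b)

lemma eventually_forall_realize {β γ : Type} [Finite α] [Finite β] (P : L.Formula ((α ⊕ β) ⊕ γ))
    (d : ∀ i, γ → M i) {A : ∀ i, Set (α → M i)} {B : ∀ i, Set (β → M i)}
    (h : ∀ x ∈ internalSet U A, ∀ y ∈ internalSet U B,
      P.Realize (Sum.elim (Sum.elim x y) (ultraTuple U d))) :
    ∀ᶠ i in (U : Filter I), ∀ x ∈ A i, ∀ y ∈ B i, P.Realize (Sum.elim (Sum.elim x y) (d i)) := by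
  by_contra hcon
  rw [← Ultrafilter.eventually_not] at hcon
  have hxy : ∀ i, ∃ (x : α → M i) (y : β → M i),
      (¬ ∀ x ∈ A i, ∀ y ∈ B i, P.Realize (Sum.elim (Sum.elim x y) (d i))) →
        x ∈ A i ∧ y ∈ B i ∧ ¬ P.Realize (Sum.elim (Sum.elim x y) (d i)) := by
    intro i
    by_cases hi : ∀ x ∈ A i, ∀ y ∈ B i, P.Realize (Sum.elim (Sum.elim x y) (d i))
    · exact ⟨fun _ => Classical.arbitrary _, fun _ => Classical.arbitrary _,
        fun h => absurd hi h⟩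
    · have hi' := hi
      push Not at hi'
      obtain ⟨x, hx, y, hy, hP⟩ := hi'
      exact ⟨x, y, fun _ => ⟨hx, hy, hP⟩⟩
  choose x y hxy using hxy
  have := h (ultraTuple U x) (ultraTuple_mem_internalSet.2 (hcon.mono fun i hi => (hxy i hi).1))
    (ultraTuple U y) (ultraTuple_mem_internalSet.2 (hcon.mono fun i hi => (hxy i hi).2.1))
  rw [elim_ultraTuple, elim_ultraTuple, realize_ultraTuple] at this
  obtain ⟨i, hi, hi'⟩ := (hcon.and this).exists
  exact (hxy i hi).2.2 hi'

lemma eventually_isHomogeneous {β γ : Type} [Finite α] [Finite β] (R : L.Formula ((α ⊕ β) ⊕ γ))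
    (d : ∀ i, γ → M i) {A : ∀ i, Set (α → M i)} {B : ∀ i, Set (β → M i)}
    (h : IsHomogeneous (fun x y => R.Realize (Sum.elim (Sum.elim x y) (ultraTuple U d)))
      (internalSet U A) (internalSet U B)) :
    ∀ᶠ i in (U : Filter I),
      IsHomogeneous (fun x y => R.Realize (Sum.elim (Sum.elim x y) (d i))) (A i) (B i) := by
  rcases h with h | h
  · exact (eventually_forall_realize R d h).mono fun i hi => Or.inl hi
  · exact (eventually_forall_realize R.not d h).mono fun i hi => Or.inr hi

end UltraMeasure

/-! ### Generic stability passes to ultraproducts. -/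

section NIP

open Filter Topology

variable {L : FirstOrder.Language.{u, v}} {T : L.Theory}

/-- In an NIP theory, the number of points needed to approximate a generically stable measure does
not depend on the model and on the measure. -/
lemma IsNIP.exists_uniform_approximation (hT : IsNIP.{u, v, w} T) {n k : ℕ}
    (φ : L.Formula (Fin n ⊕ Fin k)) {ε : ℝ} (hε : 0 < ε) : ∃ N : ℕ, 0 < N ∧
      ∀ (M : Type (max u v w)) [L.Structure M] [Nonempty M] [M ⊨ T]
        (μ : KeislerMeasure L M (Fin n)), μ.IsGenericallyStable →
        ∃ a : Fin N → (Fin n → M), ∀ b : Fin k → M,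
          |μ (fiber φ b) - Av a (fiber φ b : Set (Fin n → M))| ≤ ε := by
  obtain ⟨d, hd⟩ := hT n k φ
  obtain ⟨N, hN, happrox⟩ := exists_bounded_average.{max u v w} d (half_pos hε)
  refine ⟨N, hN, fun M _ _ _ μ hμ => ?_⟩
  obtain ⟨N', a, hN', ha⟩ := hμ k φ (ε / 2) (half_pos hε)
  have hsh : ¬ ShattersTuple (Set.range fun b : Fin k → M => (fiber φ b : Set (Fin n → M))) d := by
    rintro ⟨p, hp⟩
    refine hd M ⟨p, fun S => (hp S).choose_spec.1.choose, fun i S => ?_⟩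
    have h1 := (hp S).choose_spec.1.choose_spec
    have h2 := (hp S).choose_spec.2 i
    rw [← h1] at h2
    exact h2
  obtain ⟨x, hx⟩ := happrox _ hsh a hN'
  refine ⟨x, fun b => ?_⟩
  have h1 := ha b
  have h2 := hx _ ⟨b, rfl⟩
  have h3 := abs_sub_le (μ (fiber φ b)) (Av a (fiber φ b : Set (Fin n → M)))
    (Av x (fiber φ b : Set (Fin n → M)))
  linarith

/-- In an NIP theory, an ultraproduct of generically stable measures is generically stable. -/
lemma IsNIP.isGenericallyStable_ultraMeasure (hT : IsNIP.{u, v, w} T) {I : Type (max u v)}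
    (U : Ultrafilter I) (M : I → Type (max u v w)) [∀ i, L.Structure (M i)] [∀ i, Nonempty (M i)]
    [∀ i, M i ⊨ T] {n : ℕ} (μ : ∀ i, KeislerMeasure L (M i) (Fin n))
    (hμ : ∀ i, (μ i).IsGenericallyStable) : (ultraMeasure U μ).IsGenericallyStable := by
  intro k φ ε hε
  obtain ⟨N, hN, happrox⟩ := hT.exists_uniform_approximation φ hε
  choose a ha using fun i => happrox (M i) (μ i) (hμ i)
  -- As `N` is the same at every index, the l-th points form one point of the ultraproduct.
  refine ⟨N, fun l => ultraTuple U fun i => a i l, hN, fun b => ?_⟩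
  rw [← ultraTuple_ultraOut b]
  refine le_of_tendsto ((tendsto_ultraMeasure_fiber μ φ _).sub_const _).abs ?_
  have hiff : ∀ᶠ i in (U : Filter I), ∀ l : Fin N,
      a i l ∈ (fiber φ (ultraOut b i) : Set (Fin n → M i)) ↔
        (ultraTuple U fun i => a i l) ∈ (fiber φ (ultraTuple U (ultraOut b)) :
          Set (Fin n → (U : Filter I).Product M)) := by
    rw [eventually_all]
    intro l
    have h := ultraTuple_mem_internalSet (U := U) (x := fun i => a i l)
      (S := fun i => (fiber φ (ultraOut b i) : Set (Fin n → M i)))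
    rw [← coe_fiber_ultraTuple] at h
    by_cases hl : (ultraTuple U fun i => a i l) ∈ (fiber φ (ultraTuple U (ultraOut b)) :
          Set (Fin n → (U : Filter I).Product M))
    · exact (h.1 hl).mono fun i hi => iff_of_true hi hl
    · exact (Ultrafilter.eventually_not.2 fun h' => hl (h.2 h')).mono fun i hi => iff_of_false hi hl
  filter_upwards [hiff] with i hi
  have hAv : Av (fun l => ultraTuple U fun i => a i l) (fiber φ (ultraTuple U (ultraOut b)) :
      Set (Fin n → (U : Filter I).Product M)) =
        Av (a i) (fiber φ (ultraOut b i) : Set (Fin n → M i)) := by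
    classical
    unfold Av
    rw [Finset.filter_congr fun l _ => (hi l).symm]
  rw [hAv]
  exact ha i _

end NIP

/-! ### Coding finitely many formulas by one. -/

section Coding

variable {L : FirstOrder.Language.{u, v}}

/-- Finitely many formulas can be coded by one formula, whose instances include, in a structure
with at least two elements, all the instances of the given formulas. In a one-element structure
the instances of the coding formula are trivial. -/
lemma exists_coding_formula {α : Type} (l : List (Σ k : ℕ, L.Formula (α ⊕ Fin k))) :
    ∃ (K : ℕ) (Φ : L.Formula (α ⊕ Fin K)), ∀ (M : Type w) [L.Structure M] [Nonempty M],
      (Subsingleton M → ∀ c : Fin K → M, fiber Φ c = ⊤) ∧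
      (Nontrivial M → ∀ p ∈ l, ∀ b : Fin p.1 → M, ∃ c : Fin K → M, fiber Φ c = fiber p.2 b) := by
  induction l with
  | nil =>
    refine ⟨0, ⊤, fun M _ _ => ⟨fun _ c => SetLike.ext fun x => ?_, fun _ p hp => ?_⟩⟩
    · exact iff_of_true (Formula.realize_top.2 trivial) trivial
    · exact absurd hp List.not_mem_nil
  | cons p l ih =>
    obtain ⟨K, Φ, hΦ⟩ := ih
    let Γ := (Fin p.1 ⊕ Fin K) ⊕ Bool
    let e : Γ ≃ Fin (Fintype.card Γ) := Fintype.equivFin Γ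
    -- Two extra parameters act as a switch: equal values select `Φ`, distinct values select the new
    -- formula. In a one-element structure only `Φ` is ever selected, down to the initial `⊤`.
    let E : L.Formula (α ⊕ Γ) := Term.equal (Term.var (Sum.inr (Sum.inr true)))
      (Term.var (Sum.inr (Sum.inr false)))
    let Ψ : L.Formula (α ⊕ Γ) :=
      (E ⊓ Φ.relabel (Sum.map id fun j => Sum.inl (Sum.inr j))) ⊔
        (E.not ⊓ p.2.relabel (Sum.map id fun j => Sum.inl (Sum.inl j)))
    have hΨ : ∀ (M : Type w) [L.Structure M] (a : α → M) (b : Fin p.1 → M) (c : Fin K → M)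
        (t : Bool → M), (a ∈ fiber (Ψ.relabel (Sum.map id e))
          (Sum.elim (Sum.elim b c) t ∘ e.symm) ↔
            (t true = t false ∧ a ∈ fiber Φ c) ∨ (t true ≠ t false ∧ a ∈ fiber p.2 b)) := by
      intro M _ a b c t
      change (Ψ.relabel (Sum.map id e)).Realize (Sum.elim a _) ↔
        (_ ∧ Φ.Realize (Sum.elim a c)) ∨ (_ ∧ p.2.Realize (Sum.elim a b))
      have h1 : Sum.elim a (Sum.elim (Sum.elim b c) t ∘ e.symm) ∘ Sum.map id e =
          Sum.elim a (Sum.elim (Sum.elim b c) t) := by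
        funext j
        cases j <;> simp
      have h2 : Sum.elim a (Sum.elim (Sum.elim b c) t) ∘
          Sum.map id (fun j => Sum.inl (Sum.inr j)) = Sum.elim a c := by
        funext j
        cases j <;> rfl
      have h3 : Sum.elim a (Sum.elim (Sum.elim b c) t) ∘
          Sum.map id (fun j => Sum.inl (Sum.inl j)) = Sum.elim a b := by
        funext j
        cases j <;> rfl
      simp only [Formula.realize_relabel, h1, Ψ, Formula.realize_sup, Formula.realize_inf,
        Formula.realize_not, h2, h3, E, Formula.realize_equal, Term.realize_var, Sum.elim_inr,
        ne_eq]
    refine ⟨Fintype.card Γ, Ψ.relabel (Sum.map id e), fun M _ _ =>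
      ⟨fun _ c => ?_, fun _ q hq b => ?_⟩⟩
    · have hc : c = Sum.elim (Sum.elim (c ∘ e ∘ Sum.inl ∘ Sum.inl) (c ∘ e ∘ Sum.inl ∘ Sum.inr))
          (c ∘ e ∘ Sum.inr) ∘ e.symm := Subsingleton.elim _ _
      refine SetLike.ext fun x => ?_
      rw [hc, hΨ, (hΦ M).1 ‹_›]
      exact iff_of_true (Or.inl ⟨Subsingleton.elim _ _, trivial⟩) trivial
    · obtain ⟨s, t, hst⟩ := exists_pair_ne M
      rcases List.mem_cons.1 hq with rfl | hq
      · refine ⟨Sum.elim (Sum.elim b fun _ => s) (fun i => if i then s else t) ∘ e.symm,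
          SetLike.ext fun x => ?_⟩
        rw [hΨ]
        simp [hst]
      · obtain ⟨c, hc⟩ := (hΦ M).2 ‹_› q hq b
        refine ⟨Sum.elim (Sum.elim (fun _ => s) c) (fun _ => s) ∘ e.symm,
          SetLike.ext fun x => ?_⟩
        rw [hΨ, hc]
        simp

end Coding

end DistalTheory

/-! ### The compactness argument. -/

theorem theorem2p3 {L : FirstOrder.Language.{u, v}} (T : L.Theory) (hT : DistalTheory.IsDistal.{u, v, w} T)
    (m n k : ℕ) (R : L.Formula ((Fin m ⊕ Fin n) ⊕ Fin k))
    (β : ℝ) (hβ : β ∈ Set.Ioo (0 : ℝ) (1 / 2)) :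
    ∃ α ∈ Set.Ioo (0 : ℝ) 1, ∃ (k₁ k₂ : ℕ) (φ₁ : L.Formula (Fin m ⊕ Fin k₁))
      (φ₂ : L.Formula (Fin n ⊕ Fin k₂)),
      ∀ (M : Type (max u v w)) [L.Structure M] [Nonempty M] [M ⊨ T] (d : Fin k → M)
        (lam : DistalTheory.KeislerMeasure L M (Fin m))
        (mu : DistalTheory.KeislerMeasure L M (Fin n)), mu.IsGenericallyStable →
        ∃ (c₁ : Fin k₁ → M) (c₂ : Fin k₂ → M),
          α ≤ lam (DistalTheory.fiber φ₁ c₁) ∧ β ≤ mu (DistalTheory.fiber φ₂ c₂) ∧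
          DistalTheory.IsHomogeneous
            (fun (a : Fin m → M) (b : Fin n → M) => R.Realize (Sum.elim (Sum.elim a b) d))
            (DistalTheory.fiber φ₁ c₁ : Set (Fin m → M))
            (DistalTheory.fiber φ₂ c₂ : Set (Fin n → M)) := by
  by_contra! hcon
  let F₁ := Σ j : ℕ, L.Formula (Fin m ⊕ Fin j)
  let F₂ := Σ j : ℕ, L.Formula (Fin n ⊕ Fin j)
  let I := (Finset F₁ × Finset F₂) × ℕ
  have hcex : ∀ i : I, ∃ (M : Type (max u v w)) (_ : L.Structure M) (_ : Nonempty M) (_ : M ⊨ T)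
      (d : Fin k → M) (lam : DistalTheory.KeislerMeasure L M (Fin m))
      (mu : DistalTheory.KeislerMeasure L M (Fin n)),
      mu.IsGenericallyStable ∧ ∀ p ∈ i.1.1, ∀ q ∈ i.1.2, ∀ (c₁ : Fin p.1 → M) (c₂ : Fin q.1 → M),
        1 / ((i.2 : ℝ) + 2) ≤ lam (DistalTheory.fiber p.2 c₁) → β ≤ mu (DistalTheory.fiber q.2 c₂) →
        ¬ DistalTheory.IsHomogeneous (fun (a : Fin m → M) (b : Fin n → M) =>
          R.Realize (Sum.elim (Sum.elim a b) d))
          (DistalTheory.fiber p.2 c₁ : Set (Fin m → M)) (DistalTheory.fiber q.2 c₂ : Set (Fin n → M)) := by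
    rintro ⟨⟨P, Q⟩, j⟩
    obtain ⟨k₁, φ₁, hφ₁⟩ := DistalTheory.exists_coding_formula.{u, v, max u v w} P.toList
    obtain ⟨k₂, φ₂, hφ₂⟩ := DistalTheory.exists_coding_formula.{u, v, max u v w} Q.toList
    have hj : 1 / ((j : ℝ) + 2) ∈ Set.Ioo (0 : ℝ) 1 := by
      refine ⟨by positivity, (div_lt_one (by positivity)).2 ?_⟩
      have : (0 : ℝ) ≤ j := j.cast_nonneg
      linarith
    obtain ⟨M, _, _, _, d, lam, mu, hmu, h⟩ := hcon _ hj k₁ k₂ φ₁ φ₂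
    -- In a one-element model the coded sets are everything, hence homogeneous of measure 1, so it
    -- is no counterexample.
    have hM : Nontrivial M := by
      by_contra hM
      rw [not_nontrivial_iff_subsingleton] at hM
      obtain ⟨x⟩ := ‹Nonempty M›
      refine h (fun _ => x) (fun _ => x) ?_ ?_ ?_
      · rw [(hφ₁ M).1 hM, lam.top_eq_one]
        exact hj.2.le
      · rw [(hφ₂ M).1 hM, mu.top_eq_one]
        linarith [hβ.2]
      · by_cases hR : R.Realize (Sum.elim (Sum.elim (fun _ => x) fun _ => x) d)
        · refine Or.inl fun a _ b _ => ?_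
          rwa [Subsingleton.elim a fun _ => x, Subsingleton.elim b fun _ => x]
        · refine Or.inr fun a _ b _ => ?_
          rwa [Subsingleton.elim a fun _ => x, Subsingleton.elim b fun _ => x]
    refine ⟨M, _, ‹_›, ‹_›, d, lam, mu, hmu, fun p hp q hq c₁ c₂ h₁ h₂ => ?_⟩
    obtain ⟨c₁', hc₁⟩ := (hφ₁ M).2 hM p (Finset.mem_toList.2 hp) c₁
    obtain ⟨c₂', hc₂⟩ := (hφ₂ M).2 hM q (Finset.mem_toList.2 hq) c₂
    rw [← hc₁] at h₁ ⊢
    rw [← hc₂] at h₂ ⊢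
    exact h c₁' c₂' h₁ h₂
  choose M _ _ _ d lam mu hmu hM using hcex
  classical
  let U : Ultrafilter I := Ultrafilter.of Filter.atTop
  have hU : (U : Filter I) ≤ Filter.atTop := Ultrafilter.of_le _
  have hmodel : (U : Filter I).Product M ⊨ T :=
    (Theory.model_iff T).2 fun ψ hψ => (Ultraproduct.sentence_realize ψ).2 <|
      Filter.Eventually.of_forall fun i => Theory.realize_sentence_of_mem T hψ
  -- The only use of distality beyond NIP: the limit of the measures `mu` is smooth.
  have hsmooth := hT.2 _ n _ (hT.1.isGenericallyStable_ultraMeasure U M mu hmu)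
  obtain ⟨A, B, hA, hB, hAB⟩ := hsmooth.exists_homogeneous R (DistalTheory.ultraTuple U d)
    (DistalTheory.ultraMeasure U lam) hβ.2
  obtain ⟨k₁, φ₁, c₁, rfl⟩ := DistalTheory.exists_eq_fiber A
  obtain ⟨k₂, φ₂, c₂, rfl⟩ := DistalTheory.exists_eq_fiber B
  rw [← DistalTheory.ultraTuple_ultraOut c₁] at hA hAB
  rw [← DistalTheory.ultraTuple_ultraOut c₂] at hB hAB
  -- Strict inequalities in the limit hold at almost every index; halving leaves a positive bound
  -- for `lam`, while the bound β for `mu` is already strict.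
  have hlam := (DistalTheory.tendsto_ultraMeasure_fiber lam φ₁ (DistalTheory.ultraOut c₁)).eventually_const_lt
    (half_lt_self hA)
  have hmu' := (DistalTheory.tendsto_ultraMeasure_fiber mu φ₂ (DistalTheory.ultraOut c₂)).eventually_const_lt
    hB
  rw [DistalTheory.coe_fiber_ultraTuple, DistalTheory.coe_fiber_ultraTuple] at hAB
  have hhom := DistalTheory.eventually_isHomogeneous R d hAB
  obtain ⟨j, hj⟩ := exists_nat_gt
    (1 / (DistalTheory.ultraMeasure U lam (DistalTheory.fiber φ₁
      (DistalTheory.ultraTuple U (DistalTheory.ultraOut c₁))) / 2))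
  have hmem : ∀ᶠ i in (U : Filter I), (({⟨k₁, φ₁⟩}, {⟨k₂, φ₂⟩}), j) ≤ i :=
    hU (Filter.eventually_ge_atTop _)
  obtain ⟨i, h₁, h₂, h₃, h₄⟩ := (hlam.and (hmu'.and (hhom.and hmem))).exists
  refine hM i ⟨k₁, φ₁⟩ (Finset.singleton_subset_iff.1 h₄.1.1) ⟨k₂, φ₂⟩
    (Finset.singleton_subset_iff.1 h₄.1.2) (DistalTheory.ultraOut c₁ i)
    (DistalTheory.ultraOut c₂ i) ?_ h₂.le h₃
  refine le_trans ?_ h₁.le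
  rw [div_lt_iff₀ (half_pos hA)] at hj
  rw [div_le_iff₀ (by positivity)]
  have hji : (j : ℝ) ≤ i.2 := Nat.cast_le.2 h₄.2
  nlinarith
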